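/- Let $\mathbb O'=\mathbb H\oplus\mathbb H$ be the para-octonions (split octonions), with product $(q_1,q_2)(p_1,p_2)=(q_1p_1+\bar p_2q_2,\;p_2q_1+q_2\bar p_1)$, conjugation $\overline{(q_1,q_2)}=(\bar q_1,-q_2)$, inner product $\langle a,b\rangle=\mathrm{Re}(a\bar b)$ and $|a|^2=\langle a,a\rangle$; write $i=(i,0)$ and $l=(0,1)$. Let $U_1,U_2,U_3\subset\mathbb O'^3$ be the sets of triples $(x,y,z)$ with $|x|^2+|y|^2+|z|^2>0$ and with $x=1$, $y=1$, $z=1$, respectively, and let $\mathbb O'P^2=(U_1\cup U_2\cup U_3)/_\sim$, where $(a,b,c)\sim(d,e,f)$ iff $a=d\lambda$, $b=e\lambda$, $c=f\lambda$ for some $\lambda\in\mathbb O'$ with $|\lambda|^2>0$. This is a smooth $16$-manifold with charts $[1,u,v]\mapsto(u,v)$, $[u,1,v]\mapsto(u,v)$, $[u,v,1]\mapsto(u,v)$ on $U_1/_\sim$, $U_2/_\sim$, $U_3/_\sim$, and it carries the semi-Riemannian metric that in each of these charts is $$ds^2=\frac{|du|^2(1+|v|^2)+|dv|^2(1+|u|^2)-2\,\mathrm{Re}\big[(u\bar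 v)(dv\,d\bar u)\big]}{(1+|u|^2+|v|^2)^2}.$$ A local isometry is a smooth diffeomorphism between open subsets that preserves the metric. A semi-Riemannian manifold $(M,g)$ is called locally isotropic if for every $P\in M$ and any two non-zero tangent vectors $v,w\in T_PM$ with $g(v,v)=g(w,w)$ there is a local isometry $\mathcal I$, defined near $P$, with $\mathcal I(P)=P$ and $d\mathcal I_P(v)=w$. Theorem. The split octonionic plane $\mathbb O'P^2$ is not locally isotropic. More precisely, identify $T_{[1,0,0]}\mathbb O'P^2$ with $\mathbb O'\times\mathbb O'$ through the chart $[1,u,v]\mapsto(u,v)$. Then $v=(i+l,0)$ and $w=(1,l)$ are non-zero null vectors at $[1,0,0]$, and there is no local isometry $\mathcal I$ of $\mathbb O'P^2$, defined near $[1,0,0]$, with $\mathcal I([1,0,0])=[1,0,0]$ and $d\mathcal I_{[1,0,0]}(v)=w$. -/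

import Mathlib

open scoped Manifold ContDiff Topology

/-! ### Local isotropy of a manifold with a field of symmetric bilinear forms -/

section LocalIsotropy

variable {E : Type*} [NormedAddCommGroup E] [NormedSpace ℝ E]
  {H : Type*} [TopologicalSpace H] (I : ModelWithCorners ℝ E H)
  {M : Type*} [TopologicalSpace M] [ChartedSpace H M]

/-- A local isometry of `(M, g)`: a smooth diffeomorphism `f` between open subsets of `M`
with `f^* g = g`. -/
def IsLocalIsometry (g : ∀ p : M, LinearMap.BilinForm ℝ (TangentSpace I p))
    (f : PartialDiffeomorph I I M M ∞) : Prop :=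
  ∀ q ∈ f.source, ∀ a b : TangentSpace I q,
    g (f q) (mfderiv I I f q a) (mfderiv I I f q b) = g q a b

/-- Some local isometry `f` defined near `p` satisfies `f p = p` and `df_p v = w`. -/
def ExistsLocalIsometryMapping (g : ∀ p : M, LinearMap.BilinForm ℝ (TangentSpace I p))
    (p : M) (v w : TangentSpace I p) : Prop :=
  ∃ f : PartialDiffeomorph I I M M ∞, p ∈ f.source ∧ IsLocalIsometry I g f ∧
    tangentMap I I f (⟨p, v⟩ : TangentBundle I M) = ⟨p, w⟩

/-- `(M, g)` is locally isotropic: at every point `p`, any two non-zero tangent vectors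
`v`, `w` with `g(v,v) = g(w,w)` are related by a local isometry fixing `p`. -/
def IsLocallyIsotropic (g : ∀ p : M, LinearMap.BilinForm ℝ (TangentSpace I p)) : Prop :=
  ∀ (p : M) (v w : TangentSpace I p), v ≠ 0 → w ≠ 0 → g p v v = g p w w →
    ExistsLocalIsometryMapping I g p v w

end LocalIsotropy

noncomputable section

/-! ### Para-octonions (split octonions) -/

/-- The para-octonions: `ℍ ⊕ ℍ` with the split Cayley-Dickson product. The norm inherited from
`ℍ × ℍ` only serves to provide the standard topology of `ℝ⁸`. -/
def ParaOct : Type := Quaternion ℝ × Quaternion ℝ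

namespace ParaOct

open scoped Quaternion

instance : NormedAddCommGroup ParaOct :=
  inferInstanceAs (NormedAddCommGroup (Quaternion ℝ × Quaternion ℝ))

instance : NormedSpace ℝ ParaOct :=
  inferInstanceAs (NormedSpace ℝ (Quaternion ℝ × Quaternion ℝ))

/-- The para-octonion `(q₁, q₂)`. -/
def mk (q₁ q₂ : Quaternion ℝ) : ParaOct := (q₁, q₂)

instance : One ParaOct := ⟨mk 1 0⟩

/-- `(q₁,q₂)(p₁,p₂) = (q₁p₁ + p̄₂q₂, p₂q₁ + q₂p̄₁)`. -/
instance : Mul ParaOct :=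
  ⟨fun a b => mk (a.1 * b.1 + star b.2 * a.2) (b.2 * a.1 + a.2 * star b.1)⟩

/-- Conjugation `(q₁,q₂) ↦ (q̄₁, -q₂)`. -/
def conj (a : ParaOct) : ParaOct := mk (star a.1) (-a.2)

/-- The real part. -/
def re (a : ParaOct) : ℝ := a.1.re

/-- The inner product `⟨a,b⟩ = Re (a b̄)`, of signature `(4,4)`. -/
def ip (a b : ParaOct) : ℝ := re (a * conj b)

/-- The (indefinite) square norm `|a|² = ⟨a,a⟩`. -/
def nsq (a : ParaOct) : ℝ := ip a a

/-- The para-octonion `i = (i, 0)`. -/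
def i : ParaOct := mk ⟨0, 1, 0, 0⟩ 0

/-- The para-octonion `l = (0, 1)`. -/
def l : ParaOct := mk 0 1

@[simp] theorem fst_mk (p q : Quaternion ℝ) : (mk p q).1 = p := rfl
@[simp] theorem snd_mk (p q : Quaternion ℝ) : (mk p q).2 = q := rfl
@[simp] theorem fst_add (a b : ParaOct) : (a + b).1 = a.1 + b.1 := rfl
@[simp] theorem snd_add (a b : ParaOct) : (a + b).2 = a.2 + b.2 := rfl
@[simp] theorem fst_smul (r : ℝ) (a : ParaOct) : (r • a).1 = r • a.1 := rfl
@[simp] theorem snd_smul (r : ℝ) (a : ParaOct) : (r • a).2 = r • a.2 := rfl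
@[simp] theorem fst_zero : (0 : ParaOct).1 = 0 := rfl
@[simp] theorem snd_zero : (0 : ParaOct).2 = 0 := rfl
@[simp] theorem fst_one : (1 : ParaOct).1 = 1 := rfl
@[simp] theorem snd_one : (1 : ParaOct).2 = 0 := rfl
@[simp] theorem fst_mul (a b : ParaOct) : (a * b).1 = a.1 * b.1 + star b.2 * a.2 := rfl
@[simp] theorem snd_mul (a b : ParaOct) : (a * b).2 = b.2 * a.1 + a.2 * star b.1 := rfl
@[simp] theorem fst_conj (a : ParaOct) : (conj a).1 = star a.1 := rfl
@[simp] theorem snd_conj (a : ParaOct) : (conj a).2 = -a.2 := rfl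

@[ext] theorem ext {a b : ParaOct} (h₁ : a.1 = b.1) (h₂ : a.2 = b.2) : a = b := Prod.ext h₁ h₂

protected theorem one_mul (a : ParaOct) : 1 * a = a := by ext1 <;> simp
protected theorem mul_one (a : ParaOct) : a * 1 = a := by ext1 <;> simp
theorem conj_one : conj 1 = 1 := by ext1 <;> simp
theorem conj_conj (a : ParaOct) : conj (conj a) = a := by ext1 <;> simp

theorem smul_mul (r : ℝ) (a b : ParaOct) : (r • a) * b = r • (a * b) := by
  ext1 <;> simp

protected theorem mul_smul (r : ℝ) (a b : ParaOct) : a * (r • b) = r • (a * b) := by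
  ext1 <;> simp

theorem conj_smul (r : ℝ) (a : ParaOct) : conj (r • a) = r • conj a := by
  ext1 <;> simp

theorem conj_mul (a b : ParaOct) : conj (a * b) = conj b * conj a := by
  ext1 <;> simp [add_comm]

theorem nsq_eq (a : ParaOct) :
    nsq a = (a.1.re ^ 2 + a.1.imI ^ 2 + a.1.imJ ^ 2 + a.1.imK ^ 2)
      - (a.2.re ^ 2 + a.2.imI ^ 2 + a.2.imJ ^ 2 + a.2.imK ^ 2) := by
  simp [nsq, ip, re]; ring

theorem nsq_one : nsq 1 = 1 := by simp [nsq_eq]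

theorem nsq_conj (a : ParaOct) : nsq (conj a) = nsq a := by simp [nsq_eq]

theorem nsq_smul (r : ℝ) (a : ParaOct) : nsq (r • a) = r ^ 2 * nsq a := by
  simp [nsq_eq]; ring

theorem nsq_mul (a b : ParaOct) : nsq (a * b) = nsq a * nsq b := by
  simp [nsq_eq]; ring

theorem mul_conj_self (a : ParaOct) : a * conj a = nsq a • (1 : ParaOct) := by
  ext <;> simp [nsq_eq] <;> ring

theorem mul_mul_conj (a b : ParaOct) : (a * b) * conj b = nsq b • a := by
  ext <;> simp [nsq_eq] <;> ring

theorem mul_conj_mul (a b : ParaOct) : (a * conj b) * b = nsq b • a := by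
  simpa [conj_conj, nsq_conj] using mul_mul_conj a (conj b)

theorem conj_mul_mul (a b : ParaOct) : conj b * (b * a) = nsq b • a := by
  ext <;> simp [nsq_eq] <;> ring


theorem core_identity (x y a : ParaOct)
    (h : x = a ∨ y = a ∨ x = y ∨ x = 1 ∨ y = 1 ∨ a = 1) :
    (x * conj a) * (a * conj y) = nsq a • (x * conj y) := by
  rcases h with rfl | rfl | rfl | rfl | rfl | rfl
  · rw [mul_conj_self, smul_mul, ParaOct.one_mul]
  · rw [mul_conj_self, ParaOct.mul_smul, ParaOct.mul_one]
  · have h := mul_conj_self (x * conj a)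
    rw [conj_mul, conj_conj] at h
    rw [h, mul_conj_self, nsq_mul, nsq_conj, smul_smul, mul_comm]
  · rw [ParaOct.one_mul, ParaOct.one_mul, conj_mul_mul]
  · rw [conj_one, ParaOct.mul_one, ParaOct.mul_one, mul_conj_mul]
  · rw [conj_one, ParaOct.mul_one, ParaOct.one_mul, nsq_one, one_smul]

theorem contDiff_star : ContDiff ℝ ∞ (fun q : Quaternion ℝ => star q) := by
  let L : Quaternion ℝ →ₗ[ℝ] Quaternion ℝ :=
    { toFun := star, map_add' := star_add, map_smul' := fun r q => by simp }
  exact (LinearMap.toContinuousLinearMap L).contDiff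

theorem contDiff_mul : ContDiff ℝ ∞ (fun x : ParaOct × ParaOct => x.1 * x.2) := by
  have h := contDiff_star
  have h1 : ContDiff ℝ ∞ (fun x : (Quaternion ℝ × Quaternion ℝ) × (Quaternion ℝ × Quaternion ℝ) =>
      ((x.1.1 * x.2.1 + star x.2.2 * x.1.2, x.2.2 * x.1.1 + x.1.2 * star x.2.1) :
        Quaternion ℝ × Quaternion ℝ)) := by
    refine ContDiff.prodMk (ContDiff.add ?_ ?_) (ContDiff.add ?_ ?_)
    · fun_prop
    · exact ContDiff.mul (h.comp (by fun_prop)) (by fun_prop)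
    · fun_prop
    · exact ContDiff.mul (by fun_prop) (h.comp (by fun_prop))
  exact h1

theorem contDiff_conj : ContDiff ℝ ∞ conj := by
  have h1 : ContDiff ℝ ∞ (fun x : Quaternion ℝ × Quaternion ℝ =>
      ((star x.1, -x.2) : Quaternion ℝ × Quaternion ℝ)) :=
    (contDiff_star.comp contDiff_fst).prodMk contDiff_snd.neg
  exact h1

theorem contDiff_nsq : ContDiff ℝ ∞ nsq := by
  have h : ContDiff ℝ ∞ (fun x : Quaternion ℝ × Quaternion ℝ => ‖x.1‖ ^ 2 - ‖x.2‖ ^ 2) :=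
    (contDiff_fst.norm_sq ℝ).sub (contDiff_snd.norm_sq ℝ)
  have e : nsq = fun x : Quaternion ℝ × Quaternion ℝ => ‖x.1‖ ^ 2 - ‖x.2‖ ^ 2 := by
    funext x
    rw [nsq_eq, sq ‖x.1‖, sq ‖x.2‖, ← Quaternion.normSq_eq_norm_mul_self,
      ← Quaternion.normSq_eq_norm_mul_self, Quaternion.normSq_def', Quaternion.normSq_def']
  rw [e]
  exact h

protected theorem add_mul (a b c : ParaOct) : (a + b) * c = a * c + b * c := by
  ext1 <;> simp [_root_.add_mul, _root_.mul_add] <;> abel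

protected theorem mul_add (a b c : ParaOct) : a * (b + c) = a * b + a * c := by
  ext1 <;> simp [_root_.add_mul, _root_.mul_add] <;> abel

theorem conj_add (a b : ParaOct) : conj (a + b) = conj a + conj b := by
  ext1 <;> simp [add_comm]

theorem re_add (a b : ParaOct) : re (a + b) = re a + re b := rfl

theorem re_smul (r : ℝ) (a : ParaOct) : re (r • a) = r * re a := rfl

end ParaOct

/-! ### The para-octonionic projective plane -/

open ParaOct
open scoped Quaternion

/-- `U_i ⊂ 𝕆'³`: triples `p` with `p_i = 1` and `|p_0|² + |p_1|² + |p_2|² > 0`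
(indices run over `0, 1, 2`). -/
def affinePiece (i : Fin 3) : Set (Fin 3 → ParaOct) :=
  {p | p i = 1 ∧ 0 < ∑ j, nsq (p j)}

/-- The set `𝒰 = U_0 ∪ U_1 ∪ U_2` of reduced homogeneous coordinates. -/
def reducedTriples : Set (Fin 3 → ParaOct) := ⋃ i, affinePiece i

/-- `p ∼ q` iff `p = q λ` for some `λ` with `|λ|² > 0`. -/
def PlaneRel (p q : Fin 3 → ParaOct) : Prop :=
  ∃ lam : ParaOct, 0 < nsq lam ∧ ∀ j, p j = q j * lam

/-- For related reduced triples, the products `p_j p̄_k` are proportional. -/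
theorem PlaneRel.mul_conj {p q : Fin 3 → ParaOct} (hp : p ∈ reducedTriples)
    (hq : q ∈ reducedTriples) {lam : ParaOct} (h : ∀ j, p j = q j * lam) (j k : Fin 3) :
    p j * conj (p k) = nsq lam • (q j * conj (q k)) := by
  obtain ⟨a, ha, -⟩ := Set.mem_iUnion.1 hp
  obtain ⟨b, hb, -⟩ := Set.mem_iUnion.1 hq
  have h1 : q a * lam = 1 := by rw [← h a, ha]
  have hn : nsq (q a) * nsq lam = 1 := by rw [← nsq_mul, h1, nsq_one]
  have hn0 : nsq (q a) ≠ 0 := left_ne_zero_of_mul_eq_one hn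
  have hl : lam = (nsq (q a))⁻¹ • conj (q a) := by
    have h2 := conj_mul_mul lam (q a)
    rw [h1, ParaOct.mul_one] at h2
    rw [h2, smul_smul, inv_mul_cancel₀ hn0, one_smul]
  have hcond : q j = q a ∨ q k = q a ∨ q j = q k ∨ q j = 1 ∨ q k = 1 ∨ q a = 1 := by
    by_cases h1 : j = a
    · left; rw [h1]
    by_cases h2 : k = a
    · right; left; rw [h2]
    by_cases h3 : j = k
    · right; right; left; rw [h3]
    have : b = j ∨ b = k ∨ b = a := by omega
    rcases this with rfl | rfl | rfl <;> simp [hb]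
  rw [h j, h k, hl, conj_mul, conj_smul, conj_conj, ParaOct.mul_smul, smul_mul, smul_mul,
    ParaOct.mul_smul, core_identity _ _ _ hcond, nsq_smul, nsq_conj, smul_smul, smul_smul]
  congr 1
  field_simp

theorem PlaneRel.of_proportional {p q : Fin 3 → ParaOct} (hp : p ∈ reducedTriples) {c : ℝ}
    (hc : 0 < c) (h : ∀ j k, p j * conj (p k) = c • (q j * conj (q k))) : PlaneRel p q := by
  obtain ⟨a, ha, -⟩ := Set.mem_iUnion.1 hp
  have haa : c * nsq (q a) = 1 := by
    have h1 := congrArg re (h a a)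
    rw [ha, conj_one, ParaOct.mul_one, re_smul] at h1
    exact h1.symm
  have hpos : 0 < nsq (q a) := by
    by_contra hcon
    nlinarith [not_lt.1 hcon]
  refine ⟨c • conj (q a), ?_, fun j => ?_⟩
  · rw [nsq_smul, nsq_conj]; positivity
  · have h1 := h j a
    rw [ha, conj_one, ParaOct.mul_one] at h1
    rw [h1, ParaOct.mul_smul]

theorem planeRel_equivalence :
    Equivalence (fun p q : reducedTriples => PlaneRel p.1 q.1) where
  refl p := ⟨1, by rw [nsq_one]; exact one_pos, fun j => (ParaOct.mul_one _).symm⟩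
  symm := by
    rintro p q ⟨lam, hl, h⟩
    refine PlaneRel.of_proportional q.2 (inv_pos.2 hl) fun j k => ?_
    rw [PlaneRel.mul_conj p.2 q.2 h, smul_smul, inv_mul_cancel₀ hl.ne', one_smul]
  trans := by
    rintro p q r ⟨lam, hl, h⟩ ⟨mu, hm, h'⟩
    refine PlaneRel.of_proportional p.2 (mul_pos hl hm) fun j k => ?_
    rw [PlaneRel.mul_conj p.2 q.2 h, PlaneRel.mul_conj q.2 r.2 h', smul_smul]

instance planeSetoid : Setoid reducedTriples := ⟨_, planeRel_equivalence⟩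

/-- The para-octonionic projective plane `𝕆'P² = 𝒰/∼`. -/
def ParaOctPlane : Type := Quotient planeSetoid

/-- The model space `𝕆' × 𝕆' = ℝ¹⁶` of the charts. -/
abbrev ParaOctPair : Type := ParaOct × ParaOct

namespace ParaOctPlane

/-- The quotient topology. -/
instance : TopologicalSpace ParaOctPlane := inferInstanceAs (TopologicalSpace (Quotient planeSetoid))

/-- The class `[p_0, p_1, p_2]`. -/
def mk (p : reducedTriples) : ParaOctPlane := Quotient.mk planeSetoid p

theorem isQuotientMap_mk : Topology.IsQuotientMap mk := isQuotientMap_quotient_mk'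

/-- `p_j p_i⁻¹` for `P = [p]`: for `P ∈ U_i/∼` this is the `j`-th coordinate of the
representative of `P` whose `i`-th coordinate is `1`. -/
def coord (i j : Fin 3) : ParaOctPlane → ParaOct :=
  Quotient.lift (fun p : reducedTriples => (nsq (p.1 i))⁻¹ • (p.1 j * conj (p.1 i))) (by
    rintro p q ⟨lam, hl, h⟩
    have hn : nsq (p.1 i) = nsq (q.1 i) * nsq lam := by rw [h i, nsq_mul]
    rw [PlaneRel.mul_conj p.2 q.2 h, hn, smul_smul, mul_inv, mul_assoc,
      inv_mul_cancel₀ hl.ne', _root_.mul_one])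

/-- The triple with `1` in position `i` and `u`, `v` in the remaining two positions, in order. -/
def insertOne (i : Fin 3) (x : ParaOctPair) : Fin 3 → ParaOct :=
  i.insertNth (α := fun _ => ParaOct) 1 ![x.1, x.2]

@[simp] theorem insertOne_same (i : Fin 3) (x : ParaOctPair) : insertOne i x i = 1 := by
  simp [insertOne]

@[simp] theorem insertOne_zero (i : Fin 3) (x : ParaOctPair) :
    insertOne i x (i.succAbove 0) = x.1 := by
  simp [insertOne]

@[simp] theorem insertOne_one (i : Fin 3) (x : ParaOctPair) :
    insertOne i x (i.succAbove 1) = x.2 := by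
  simp [insertOne]

theorem insertOne_eta {i : Fin 3} {p : Fin 3 → ParaOct} (hp : p i = 1) :
    insertOne i (p (i.succAbove 0), p (i.succAbove 1)) = p := by
  funext j
  rcases Fin.eq_self_or_eq_succAbove i j with rfl | ⟨k, rfl⟩
  · simp [hp]
  · fin_cases k
    · exact insertOne_zero _ _
    · exact insertOne_one _ _

theorem sum_nsq_insertOne (i : Fin 3) (x : ParaOctPair) :
    ∑ j, nsq (insertOne i x j) = 1 + nsq x.1 + nsq x.2 := by
  rw [Fin.sum_univ_succAbove _ i, Fin.sum_univ_two]
  simp [nsq_one, add_assoc]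

/-- The common image of the three charts: `1 + |u|² + |v|² > 0`. -/
def chartTarget : Set ParaOctPair := {x | 0 < 1 + nsq x.1 + nsq x.2}

theorem insertOne_mem_affinePiece {i : Fin 3} {x : ParaOctPair} (hx : x ∈ chartTarget) :
    insertOne i x ∈ affinePiece i :=
  ⟨insertOne_same i x, by rw [sum_nsq_insertOne]; exact hx⟩

theorem pair_mem_chartTarget {i : Fin 3} {p : Fin 3 → ParaOct} (hp : p ∈ affinePiece i) :
    (p (i.succAbove 0), p (i.succAbove 1)) ∈ chartTarget := by
  have h := hp.2
  rw [← insertOne_eta hp.1, sum_nsq_insertOne] at h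
  exact h

/-- The triple `insertOne i x` as an element of `𝒰`. -/
def insertTriple (i : Fin 3) (x : chartTarget) : reducedTriples :=
  ⟨insertOne i x.1, Set.mem_iUnion.2 ⟨i, insertOne_mem_affinePiece x.2⟩⟩

/-- The base point `[1, 0, 0]`. -/
def basePoint : ParaOctPlane :=
  mk ⟨![1, 0, 0], Set.mem_iUnion.2 ⟨0, rfl, by simp [Fin.sum_univ_three, nsq_eq]⟩⟩

open Classical in
/-- `(u, v) ↦ [1, u, v]`, `[u, 1, v]` or `[u, v, 1]`, for `i = 0, 1, 2`
(with a dummy value outside the image of the chart). -/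
def chartInv (i : Fin 3) (x : ParaOctPair) : ParaOctPlane :=
  if hx : x ∈ chartTarget then mk (insertTriple i ⟨x, hx⟩) else basePoint

theorem chartInv_of_mem {i : Fin 3} {x : ParaOctPair} (hx : x ∈ chartTarget) :
    chartInv i x = mk (insertTriple i ⟨x, hx⟩) := dif_pos hx

/-- The chart domain `U_i/∼`. -/
def chartSource (i : Fin 3) : Set ParaOctPlane := mk '' {p | p.1 ∈ affinePiece i}

theorem mk_mem_chartSource {i : Fin 3} {p : reducedTriples} :
    mk p ∈ chartSource i ↔ 0 < nsq (p.1 i) := by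
  constructor
  · rintro ⟨q, ⟨hq, -⟩, hqp⟩
    obtain ⟨lam, hl, h⟩ : PlaneRel q.1 p.1 := Quotient.exact hqp
    have h1 : nsq (p.1 i) * nsq lam = 1 := by rw [← nsq_mul, ← h i, hq, nsq_one]
    by_contra hcon
    nlinarith [not_lt.1 hcon]
  · intro hi
    have hc : 0 < nsq ((nsq (p.1 i))⁻¹ • conj (p.1 i)) := by
      rw [nsq_smul, nsq_conj]; positivity
    let q : Fin 3 → ParaOct := fun j => p.1 j * ((nsq (p.1 i))⁻¹ • conj (p.1 i))
    have hq : q ∈ affinePiece i := by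
      refine ⟨?_, ?_⟩
      · simp only [q]
        rw [ParaOct.mul_smul, mul_conj_self, smul_smul, inv_mul_cancel₀ hi.ne', one_smul]
      · obtain ⟨b, -, hb⟩ := Set.mem_iUnion.1 p.2
        simp only [q, nsq_mul, ← Finset.sum_mul]
        exact mul_pos hb hc
    exact ⟨⟨q, Set.mem_iUnion.2 ⟨i, hq⟩⟩, hq, Quotient.sound ⟨_, hc, fun _ => rfl⟩⟩

theorem coord_mk (i j : Fin 3) (p : reducedTriples) :
    coord i j (mk p) = (nsq (p.1 i))⁻¹ • (p.1 j * conj (p.1 i)) := rfl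

theorem coord_mk_of_eq_one {i j : Fin 3} {p : reducedTriples} (hp : p.1 i = 1) :
    coord i j (mk p) = p.1 j := by
  rw [coord_mk, hp, conj_one, nsq_one, ParaOct.mul_one, inv_one, one_smul]

/-- The underlying bijection of the chart `φ_i`. -/
def chartEquiv (i : Fin 3) : PartialEquiv ParaOctPlane ParaOctPair where
  toFun P := (coord i (i.succAbove 0) P, coord i (i.succAbove 1) P)
  invFun := chartInv i
  source := chartSource i
  target := chartTarget
  map_source' := by
    rintro _ ⟨p, ⟨hp, hpos⟩, rfl⟩
    rw [coord_mk_of_eq_one hp, coord_mk_of_eq_one hp]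
    exact pair_mem_chartTarget ⟨hp, hpos⟩
  map_target' x hx := by
    rw [chartInv, dif_pos hx]
    exact ⟨_, insertOne_mem_affinePiece hx, rfl⟩
  left_inv' := by
    rintro _ ⟨p, ⟨hp, hpos⟩, rfl⟩
    rw [coord_mk_of_eq_one hp, coord_mk_of_eq_one hp]
    have hx : (p.1 (i.succAbove 0), p.1 (i.succAbove 1)) ∈ chartTarget :=
      pair_mem_chartTarget ⟨hp, hpos⟩
    rw [chartInv, dif_pos hx]
    congr 1
    exact Subtype.ext (insertOne_eta hp)
  right_inv' x hx := by
    rw [chartInv, dif_pos hx, coord_mk_of_eq_one (insertOne_same i x),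
      coord_mk_of_eq_one (insertOne_same i x)]
    simp [insertTriple]

theorem isOpen_chartTarget : IsOpen chartTarget := by
  have h := contDiff_nsq.continuous
  exact isOpen_lt continuous_const (by fun_prop)

theorem continuous_apply_val (i : Fin 3) : Continuous fun p : reducedTriples => p.1 i :=
  (continuous_apply i).comp continuous_subtype_val

theorem isOpen_chartSource (i : Fin 3) : IsOpen (chartSource i) := by
  rw [← isQuotientMap_mk.isOpen_preimage]
  have h : mk ⁻¹' chartSource i = {p | 0 < nsq (p.1 i)} := by
    ext p; exact mk_mem_chartSource
  rw [h]
  exact isOpen_lt continuous_const (contDiff_nsq.continuous.comp (continuous_apply_val i))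

theorem continuous_insertOne (i : Fin 3) : Continuous (insertOne i) := by
  refine continuous_pi fun j => ?_
  rcases Fin.eq_self_or_eq_succAbove i j with rfl | ⟨k, rfl⟩
  · simp only [insertOne_same]; exact continuous_const
  · fin_cases k
    · exact continuous_fst.congr fun x => (insertOne_zero i x).symm
    · exact continuous_snd.congr fun x => (insertOne_one i x).symm

theorem continuousOn_coord (i j : Fin 3) : ContinuousOn (coord i j) (chartSource i) := by
  rw [isQuotientMap_mk.continuousOn_isOpen_iff (isOpen_chartSource i)]
  have h1 := contDiff_nsq.continuous
  have h2 := contDiff_mul.continuous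
  have h3 := contDiff_conj.continuous
  have h4 : ContinuousOn (fun p : reducedTriples => (nsq (p.1 i))⁻¹ • (p.1 j * conj (p.1 i)))
      (mk ⁻¹' chartSource i) := by
    refine ContinuousOn.fun_smul (f := fun p : reducedTriples => (nsq (p.1 i))⁻¹)
      (g := fun p : reducedTriples => p.1 j * conj (p.1 i))
      (ContinuousOn.inv₀ (f := fun p : reducedTriples => nsq (p.1 i)) ?_ fun p hp => ?_) ?_
    · exact (h1.comp (continuous_apply_val i)).continuousOn
    · exact (mk_mem_chartSource.1 hp).ne'
    · have h5 : Continuous fun p : reducedTriples => (p.1 j, conj (p.1 i)) :=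
        (continuous_apply_val j).prodMk (h3.comp (continuous_apply_val i))
      exact (h2.comp h5).continuousOn
  exact h4

/-- The chart `φ_i` on `U_i/∼`: `φ_0 [1,u,v] = (u,v)`, `φ_1 [u,1,v] = (u,v)`,
`φ_2 [u,v,1] = (u,v)`. -/
def chart (i : Fin 3) : OpenPartialHomeomorph ParaOctPlane ParaOctPair where
  toPartialEquiv := chartEquiv i
  open_source := isOpen_chartSource i
  open_target := isOpen_chartTarget
  continuousOn_toFun := (continuousOn_coord i _).prodMk (continuousOn_coord i _)
  continuousOn_invFun := by
    rw [continuousOn_iff_continuous_domRestrict]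
    have h : Continuous fun x : chartTarget => mk (insertTriple i x) := by
      refine isQuotientMap_mk.continuous.comp ?_
      exact ((continuous_insertOne i).comp continuous_subtype_val).subtype_mk _
    refine h.congr fun x => ?_
    exact (chartInv_of_mem x.2).symm

theorem exists_mem_chartSource (P : ParaOctPlane) : ∃ i, P ∈ chartSource i := by
  obtain ⟨p, rfl⟩ := isQuotientMap_mk.surjective P
  obtain ⟨i, hi⟩ := Set.mem_iUnion.1 p.2
  exact ⟨i, p, hi, rfl⟩

open Classical in
/-- The first index `i` with `P ∈ U_i/∼`. -/
def chartIndex (P : ParaOctPlane) : Fin 3 := Fin.find (P ∈ chartSource ·) (exists_mem_chartSource P)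

/-- The atlas `φ_0, φ_1, φ_2`. -/
instance : ChartedSpace ParaOctPair ParaOctPlane where
  atlas := Set.range chart
  chartAt P := chart (chartIndex P)
  mem_chart_source P := by
    classical exact Fin.find_spec (exists_mem_chartSource P)
  chart_mem_atlas P := ⟨_, rfl⟩

theorem chartAt_eq (P : ParaOctPlane) : chartAt ParaOctPair P = chart (chartIndex P) := rfl

theorem contDiff_insertOne (i j : Fin 3) : ContDiff ℝ ∞ fun x => insertOne i x j := by
  rcases Fin.eq_self_or_eq_succAbove i j with rfl | ⟨k, rfl⟩
  · simp only [insertOne_same]; exact contDiff_const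
  · fin_cases k
    · have h : (fun x => insertOne i x (i.succAbove 0)) = Prod.fst := funext (insertOne_zero i)
      exact h ▸ contDiff_fst
    · have h : (fun x => insertOne i x (i.succAbove 1)) = Prod.snd := funext (insertOne_one i)
      exact h ▸ contDiff_snd

/-- The transition maps are smooth. -/
instance : IsManifold 𝓘(ℝ, ParaOctPair) ∞ ParaOctPlane := by
  apply isManifold_of_contDiffOn
  rintro _ _ ⟨i, rfl⟩ ⟨j, rfl⟩
  have hs : ∀ x ∈ ((chart i).symm ≫ₕ chart j).source,
      x ∈ chartTarget ∧ nsq (insertOne i x j) ≠ 0 := by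
    rintro x ⟨hx, hx'⟩
    have hx1 : x ∈ chartTarget := hx
    have hx2 : chartInv i x ∈ chartSource j := hx'
    rw [chartInv_of_mem hx1, mk_mem_chartSource] at hx2
    exact ⟨hx1, hx2.ne'⟩
  have key : ∀ k, ContDiffOn ℝ ∞ (fun x => coord j k (chartInv i x))
      ((chart i).symm ≫ₕ chart j).source := by
    intro k
    have h1 : ContDiffOn ℝ ∞ (fun x => (nsq (insertOne i x j))⁻¹ •
        (insertOne i x k * conj (insertOne i x j))) ((chart i).symm ≫ₕ chart j).source := by
      refine ContDiffOn.smul (ContDiffOn.inv ?_ fun x hx => (hs x hx).2) ?_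
      · exact (contDiff_nsq.comp (contDiff_insertOne i j)).contDiffOn
      · exact (contDiff_mul.comp ((contDiff_insertOne i k).prodMk
          (contDiff_conj.comp (contDiff_insertOne i j)))).contDiffOn
    refine h1.congr fun x hx => ?_
    rw [chartInv_of_mem (hs x hx).1]
    rfl
  have h := (key (j.succAbove 0)).prodMk (key (j.succAbove 1))
  simp only [modelWithCornersSelf_coe, modelWithCornersSelf_coe_symm, Function.id_comp,
    Function.comp_id, Set.range_id, Set.inter_univ, Set.preimage_id_eq, id_eq]
  exact h

/-! ### The metric -/

/-- The symmetric bilinear form at `x = (u, v)` whose quadratic form is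
`ds² = (|du|²(1+|v|²) + |dv|²(1+|u|²) - 2 Re[(u v̄)(dv dū)]) / (1+|u|²+|v|²)²`. -/
def metricForm (x : ParaOctPair) : LinearMap.BilinForm ℝ ParaOctPair :=
  LinearMap.mk₂ ℝ
    (fun a b => (ip a.1 b.1 * (1 + nsq x.2) + ip a.2 b.2 * (1 + nsq x.1)
      - re ((x.1 * conj x.2) * (a.2 * conj b.1)) - re ((x.1 * conj x.2) * (b.2 * conj a.1)))
        / (1 + nsq x.1 + nsq x.2) ^ 2)
    (fun a a' b => by
      simp only [ip, Prod.fst_add, Prod.snd_add, ParaOct.add_mul, ParaOct.mul_add, conj_add, re_add]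
      ring)
    (fun c a b => by
      simp only [ip, Prod.smul_fst, Prod.smul_snd, smul_mul, ParaOct.mul_smul, conj_smul, re_smul,
        smul_eq_mul]
      ring)
    (fun a b b' => by
      simp only [ip, Prod.fst_add, Prod.snd_add, ParaOct.add_mul, ParaOct.mul_add, conj_add, re_add]
      ring)
    (fun c a b => by
      simp only [ip, Prod.smul_fst, Prod.smul_snd, smul_mul, ParaOct.mul_smul, conj_smul, re_smul,
        smul_eq_mul]
      ring)

/-- On the diagonal `metricForm` is the line element `ds²`. -/
theorem metricForm_self (u v du dv : ParaOct) :
    metricForm (u, v) (du, dv) (du, dv) =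
      (nsq du * (1 + nsq v) + nsq dv * (1 + nsq u) - 2 * re ((u * conj v) * (dv * conj du)))
        / (1 + nsq u + nsq v) ^ 2 := by
  simp only [metricForm, LinearMap.mk₂_apply, nsq]
  ring

/-- The metric of `𝕆'P²`, given in the chart by `metricForm`. A tangent vector at `P` is
represented by its components in the chart `chartAt P`, and the expression `ds²` is invariant
under the transition maps, so that the same formula holds in all three charts. -/
def metric (P : ParaOctPlane) : LinearMap.BilinForm ℝ (TangentSpace 𝓘(ℝ, ParaOctPair) P) :=
  metricForm (chartAt ParaOctPair P P)

/-- Tangent vectors at `[1,0,0]` are represented by their components in the chart `φ_0`. -/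
theorem chartAt_basePoint : chartAt ParaOctPair basePoint = chart 0 := by
  classical
  rw [chartAt_eq]
  congr 1
  have h : basePoint ∈ chartSource 0 := by
    rw [basePoint, mk_mem_chartSource]
    simp [nsq_eq]
  exact (Fin.find_eq_iff _).2 ⟨h, fun j hj => absurd hj (Fin.not_lt_zero j)⟩

/-- The tangent vector `(a, b)` at `[1,0,0]`. -/
def baseVec (a b : ParaOct) : TangentSpace 𝓘(ℝ, ParaOctPair) basePoint := ((a, b) : ParaOctPair)

end ParaOctPlane

end

/-!
Suppose an isometry `F` fixes a point at which, in some coordinates, `g` is stationary.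
Differentiating `F^* g = g` once gives a trilinear form in `D²F` that is symmetric in its first two
arguments and antisymmetric in its last two, so `D²F = 0`. Differentiating twice, the terms in `D³F`
cancel from the combination of second derivatives of `g` that forms the numerator of the sectional
curvature, so this numerator is preserved by `DF`.

At `[1, 0, 0]` the metric is an even function of the chart coordinates, hence stationary. There the
numerator for the plane of `(u, 0)` and `(a₁, a₂)` is `4 (|u|²|a₁|² - ⟨u, a₁⟩²) + |u|²|a₂|²`, which
is nowhere positive when `u` is null, whereas for the plane of `(1, l)` and `(i, 0)` it is `3`. Thus
`(1, l)` is not the image of `(u, 0)` for any null `u`, in particular not for `u = i + l`.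
-/

-- Instances on the iterated operator spaces in which third derivatives live need this depth.
set_option maxSynthPendingDepth 3

/-! ### Isometries at a stationary point of the metric -/

theorem eq_zero_of_symm_of_antisymm {α R : Type*} [AddGroup R] [IsAddTorsionFree R]
    {c : α → α → α → R} (hsymm : ∀ x y z, c x y z = c y x z)
    (hanti : ∀ x y z, c x y z = -c x z y) (x y z : α) : c x y z = 0 := by
  refine self_eq_neg.1 ?_
  calc c x y z = -c z x y := by rw [hanti, hsymm]
    _ = c y z x := by rw [hanti, neg_neg, hsymm]
    _ = -c x y z := by rw [hanti, hsymm]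

section Isometric

variable {V W : Type*} [NormedAddCommGroup V] [NormedSpace ℝ V]
  [NormedAddCommGroup W] [NormedSpace ℝ W]

theorem fderiv_zero_of_even {f : V → W} (hf : Function.Even f) : fderiv ℝ f 0 = 0 := by
  have h := (ContinuousLinearEquiv.neg ℝ).comp_right_fderiv (f := f) (x := (0 : V))
  rw [show f ∘ ContinuousLinearEquiv.neg ℝ = f from funext hf] at h
  have := IsAddTorsionFree.of_isTorsionFree ℝ W
  refine ContinuousLinearMap.ext fun v => self_eq_neg.1 ?_
  simpa using congr($h v)

theorem fderiv_fderiv_fderiv_swap_right {F : V → W} {p : V} (hF : ContDiffAt ℝ 3 F p) (x y z : V) :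
    fderiv ℝ (fderiv ℝ (fderiv ℝ F)) p x y z = fderiv ℝ (fderiv ℝ (fderiv ℝ F)) p x z y := by
  have hD : DifferentiableAt ℝ (fderiv ℝ (fderiv ℝ F)) p :=
    ((hF.fderiv_right (m := 2) (by norm_num)).fderiv_right (m := 1) (by norm_num)).differentiableAt
      (by simp)
  have hsymm : (fun q => fderiv ℝ (fderiv ℝ F) q y z) =ᶠ[𝓝 p]
      fun q => fderiv ℝ (fderiv ℝ F) q z y := by
    filter_upwards [hF.eventually (by simp)] with q hq
    exact (hq.isSymmSndFDerivAt (by simp; norm_num)).eq y z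
  have h := congr($(hsymm.fderiv_eq (𝕜 := ℝ)) x)
  simpa [fderiv_clm_apply, hD, hD.clm_apply] using h

theorem deriv_deriv_comp_line {X : Type*} [NormedAddCommGroup X] [NormedSpace ℝ X] {f : V → W}
    {p : V} (hf : ContDiffAt ℝ 2 f p) (L : W →L[ℝ] X) (x : V) :
    deriv (deriv fun t : ℝ => L (f (p + t • x))) 0 = L (fderiv ℝ (fderiv ℝ f) p x x) := by
  have hline (t : ℝ) : HasDerivAt (fun t : ℝ => p + t • x) x t := by
    simpa using ((hasDerivAt_id t).smul_const x).const_add p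
  have hdf : DifferentiableAt ℝ (fderiv ℝ f) p :=
    (hf.fderiv_right (m := 1) (by norm_num)).differentiableAt (by simp)
  have htendsto : Filter.Tendsto (fun t : ℝ => p + t • x) (𝓝 0) (𝓝 p) := by
    simpa using (hline 0).continuousAt.tendsto
  have hfst : deriv (fun t : ℝ => L (f (p + t • x))) =ᶠ[𝓝 0]
      fun t => L (fderiv ℝ f (p + t • x) x) := by
    filter_upwards [htendsto.eventually (hf.eventually (by simp))] with t ht
    have hcomp : HasDerivAt (fun t : ℝ => f (p + t • x)) (fderiv ℝ f (p + t • x) x) t :=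
      (ht.differentiableAt (by simp)).hasFDerivAt.comp_hasDerivAt t (hline t)
    exact (L.hasFDerivAt.comp_hasDerivAt t hcomp).deriv
  have hsnd : HasDerivAt (fun t : ℝ => fderiv ℝ f (p + t • x) x)
      (fderiv ℝ (fderiv ℝ f) p x x) 0 := by
    have hcomp : HasDerivAt (fun t : ℝ => fderiv ℝ f (p + t • x))
        (fderiv ℝ (fderiv ℝ f) p x) 0 :=
      hdf.hasFDerivAt.comp_hasDerivAt_of_eq 0 (hline 0) (by simp)
    simpa using hcomp.clm_apply (hasDerivAt_const 0 x)
  rw [hfst.deriv_eq]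
  exact (L.hasFDerivAt.comp_hasDerivAt 0 hsnd).deriv

theorem deriv_deriv_div_sq (c q s : ℝ) :
    deriv (deriv fun t : ℝ => (c + t ^ 2 * q) / (1 + t ^ 2 * s) ^ 2) 0 = 2 * (q - 2 * c * s) := by
  have hpos : ∀ᶠ t : ℝ in 𝓝 0, 1 + t ^ 2 * s ≠ 0 :=
    ContinuousAt.eventually_ne (by fun_prop) (by simp)
  have hfst : (deriv fun t : ℝ => (c + t ^ 2 * q) / (1 + t ^ 2 * s) ^ 2) =ᶠ[𝓝 0]
      fun t => t * ((2 * q * (1 + t ^ 2 * s) - 4 * s * (c + t ^ 2 * q)) / (1 + t ^ 2 * s) ^ 3) := by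
    filter_upwards [hpos] with t ht
    have hsq (r : ℝ) : HasDerivAt (fun t : ℝ => t ^ 2 * r) (2 * t * r) t := by
      simpa using (hasDerivAt_pow 2 t).mul_const r
    have hdiv := ((hsq q).const_add c).div (((hsq s).const_add 1).pow 2) (pow_ne_zero 2 ht)
    refine hdiv.deriv.trans ?_
    simp only [Pi.pow_apply]
    field_simp
    ring
  have hquot : DifferentiableAt ℝ (fun t : ℝ =>
      (2 * q * (1 + t ^ 2 * s) - 4 * s * (c + t ^ 2 * q)) / (1 + t ^ 2 * s) ^ 3) 0 :=
    DifferentiableAt.fun_div (by fun_prop) (by fun_prop) (by simp)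
  rw [hfst.deriv_eq, ((hasDerivAt_id' (0 : ℝ)).fun_mul hquot.hasDerivAt).deriv]
  simp
  ring

/-- The map `F` pulls `h` back to `g` near `p`. -/
def IsIsometricNear (g : V → V →L[ℝ] V →L[ℝ] ℝ) (h : W → W →L[ℝ] W →L[ℝ] ℝ) (F : V → W)
    (p : V) : Prop :=
  ∀ᶠ x in 𝓝 p, ∀ a b, h (F x) (fderiv ℝ F x a) (fderiv ℝ F x b) = g x a b

variable {g : V → V →L[ℝ] V →L[ℝ] ℝ} {h : W → W →L[ℝ] W →L[ℝ] ℝ} {F : V → W} {p : V}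

namespace IsIsometricNear

theorem apply_self (hiso : IsIsometricNear g h F p) (a b : V) :
    h (F p) (fderiv ℝ F p a) (fderiv ℝ F p b) = g p a b :=
  hiso.self_of_nhds a b

theorem injective_fderiv (hiso : IsIsometricNear g h F p) (hg : ∀ a, (∀ b, g p a b = 0) → a = 0) :
    Function.Injective (fderiv ℝ F p) := by
  refine (injective_iff_map_eq_zero _).2 fun a ha => hg a fun b => ?_
  rw [← hiso.apply_self, ha, map_zero, zero_apply]

theorem fderiv_metric_eq (hiso : IsIsometricNear g h F p) (hF : ContDiffAt ℝ 2 F p)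
    (hg : ContDiffAt ℝ 1 g p) (hh : ContDiffAt ℝ 1 h (F p)) :
    ∀ᶠ x in 𝓝 p, ∀ y a b,
      fderiv ℝ h (F x) (fderiv ℝ F x y) (fderiv ℝ F x a) (fderiv ℝ F x b)
        + h (F x) (fderiv ℝ (fderiv ℝ F) x y a) (fderiv ℝ F x b)
        + h (F x) (fderiv ℝ F x a) (fderiv ℝ (fderiv ℝ F) x y b) = fderiv ℝ g x y a b := by
  filter_upwards [hiso.eventually_nhds, hF.eventually (by simp), hg.eventually (by simp),
    hF.continuousAt.eventually (hh.eventually (by simp))] with x hx hFx hgx hhx y a b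
  have dF := hFx.differentiableAt (by simp)
  have dF' := (hFx.fderiv_right (m := 1) (by norm_num)).differentiableAt (by simp)
  have dg := hgx.differentiableAt (by simp)
  have dh := hhx.differentiableAt (by simp)
  have heq : (fun z => h (F z) (fderiv ℝ F z a) (fderiv ℝ F z b)) =ᶠ[𝓝 x] fun z => g z a b :=
    hx.mono fun z hz => hz a b
  have hl := ((dh.hasFDerivAt.comp x dF.hasFDerivAt).clm_apply
    (dF'.hasFDerivAt.clm_apply (hasFDerivAt_const a x))).clm_apply
    (dF'.hasFDerivAt.clm_apply (hasFDerivAt_const b x))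
  have hr := (dg.hasFDerivAt.clm_apply (hasFDerivAt_const a x)).clm_apply (hasFDerivAt_const b x)
  have hdiff := congr($((hl.congr_of_eventuallyEq heq.symm).unique hr) y)
  simp only [Function.comp_apply, add_apply, ContinuousLinearMap.comp_apply,
    ContinuousLinearMap.flip_apply, zero_apply, map_zero, zero_add] at hdiff
  linarith

theorem fderiv_fderiv_map_eq_zero (hiso : IsIsometricNear g h F p) (hF : ContDiffAt ℝ 2 F p)
    (hg : ContDiffAt ℝ 1 g p) (hh : ContDiffAt ℝ 1 h (F p)) (hg' : fderiv ℝ g p = 0)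
    (hh' : fderiv ℝ h (F p) = 0) (hsymm : ∀ a b, h (F p) a b = h (F p) b a)
    (hnondeg : ∀ a, (∀ b, h (F p) a b = 0) → a = 0) (hsurj : Function.Surjective (fderiv ℝ F p)) :
    fderiv ℝ (fderiv ℝ F) p = 0 := by
  have hsnd : IsSymmSndFDerivAt ℝ F p := hF.isSymmSndFDerivAt (by simp)
  have hzero : ∀ x y z, h (F p) (fderiv ℝ (fderiv ℝ F) p x y) (fderiv ℝ F p z) = 0 := by
    refine eq_zero_of_symm_of_antisymm (fun x y z => by rw [hsnd.eq]) fun x y z => ?_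
    have hdiff := (hiso.fderiv_metric_eq hF hg hh).self_of_nhds x y z
    rw [hg', hh', hsymm (fderiv ℝ F p y)] at hdiff
    simp only [zero_apply, zero_add] at hdiff
    exact eq_neg_of_add_eq_zero_left hdiff
  ext x y
  refine hnondeg _ fun b => ?_
  obtain ⟨z, rfl⟩ := hsurj b
  exact hzero x y z

theorem fderiv_fderiv_metric_eq (hiso : IsIsometricNear g h F p) (hF : ContDiffAt ℝ 3 F p)
    (hg : ContDiffAt ℝ 2 g p) (hh : ContDiffAt ℝ 2 h (F p)) (hh' : fderiv ℝ h (F p) = 0)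
    (hF' : fderiv ℝ (fderiv ℝ F) p = 0) (x y a b : V) :
    fderiv ℝ (fderiv ℝ h) (F p) (fderiv ℝ F p x) (fderiv ℝ F p y) (fderiv ℝ F p a) (fderiv ℝ F p b)
        + h (F p) (fderiv ℝ (fderiv ℝ (fderiv ℝ F)) p x y a) (fderiv ℝ F p b)
        + h (F p) (fderiv ℝ F p a) (fderiv ℝ (fderiv ℝ (fderiv ℝ F)) p x y b) =
      fderiv ℝ (fderiv ℝ g) p x y a b := by
  have cF' := hF.fderiv_right (m := 2) (by norm_num)
  have dF := (hF.differentiableAt (by simp)).hasFDerivAt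
  have dF' := (cF'.differentiableAt (by simp)).hasFDerivAt
  have dF'' := ((cF'.fderiv_right (m := 1) (by norm_num)).differentiableAt (by simp)).hasFDerivAt
  have dg' := ((hg.fderiv_right (m := 1) (by norm_num)).differentiableAt (by simp)).hasFDerivAt
  have dh := (hh.differentiableAt (by simp)).hasFDerivAt.comp p dF
  have dh' := ((hh.fderiv_right (m := 1) (by norm_num)).differentiableAt
    (by simp)).hasFDerivAt.comp p dF
  have dconst (c : V) := hasFDerivAt_const (𝕜 := ℝ) c p
  have dF'_apply (c : V) := dF'.clm_apply (dconst c)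
  have dF''_apply (c : V) := (dF''.clm_apply (dconst y)).clm_apply (dconst c)
  have hl := (((dh'.clm_apply (dF'_apply y)).clm_apply (dF'_apply a)).clm_apply (dF'_apply b)).add
    ((dh.clm_apply (dF''_apply a)).clm_apply (dF'_apply b)) |>.add
    ((dh.clm_apply (dF'_apply a)).clm_apply (dF''_apply b))
  have hr := ((dg'.clm_apply (dconst y)).clm_apply (dconst a)).clm_apply (dconst b)
  have heq := (hiso.fderiv_metric_eq (hF.of_le (by norm_num)) (hg.of_le (by norm_num))
    (hh.of_le (by norm_num))).mono fun z hz => hz y a b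
  simpa [hF', hh'] using congr($(hl.unique (hr.congr_of_eventuallyEq heq)) x)

end IsIsometricNear

/-- At a point where the first derivative of `g` vanishes, so that the Christoffel symbols do, this
is the value `R(x, a, a, x)` of the curvature tensor: the numerator of the sectional curvature of
the plane spanned by `x` and `a`. -/
noncomputable def sectionalForm (g : V → V →L[ℝ] V →L[ℝ] ℝ) (p x a : V) : ℝ :=
  fderiv ℝ (fderiv ℝ g) p x a x a
    - (fderiv ℝ (fderiv ℝ g) p x x a a + fderiv ℝ (fderiv ℝ g) p a a x x) / 2

theorem deriv_deriv_apply_apply (hg : ContDiffAt ℝ 2 g p) (x a b : V) :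
    deriv (deriv fun t : ℝ => g (p + t • x) a b) 0 = fderiv ℝ (fderiv ℝ g) p x x a b :=
  deriv_deriv_comp_line hg
    ((ContinuousLinearMap.apply ℝ ℝ b).comp (ContinuousLinearMap.apply ℝ (V →L[ℝ] ℝ) a)) x

theorem sectionalForm_eq_diag (hg : ContDiffAt ℝ 2 g p) (x a : V) :
    sectionalForm g p x a =
      (fderiv ℝ (fderiv ℝ g) p (x + a) (x + a) x a - fderiv ℝ (fderiv ℝ g) p x x x a
        - fderiv ℝ (fderiv ℝ g) p a a x a - fderiv ℝ (fderiv ℝ g) p x x a a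
        - fderiv ℝ (fderiv ℝ g) p a a x x) / 2 := by
  have hsnd : IsSymmSndFDerivAt ℝ g p := hg.isSymmSndFDerivAt (by simp)
  simp only [sectionalForm, map_add, add_apply, hsnd.eq a x]
  ring

theorem sectionalForm_comm (hg : ContDiffAt ℝ 2 g p) (hsymm : ∀ x a b, g x a b = g x b a)
    (x a : V) : sectionalForm g p x a = sectionalForm g p a x := by
  have hdiag (y : V) :
      fderiv ℝ (fderiv ℝ g) p y y x a = fderiv ℝ (fderiv ℝ g) p y y a x := by
    simp only [← deriv_deriv_apply_apply hg, hsymm _ x a]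
  rw [sectionalForm_eq_diag hg, sectionalForm_eq_diag hg, hdiag, hdiag, hdiag, add_comm x a]
  ring

theorem IsIsometricNear.sectionalForm_eq (hiso : IsIsometricNear g h F p) (hF : ContDiffAt ℝ 3 F p)
    (hg : ContDiffAt ℝ 2 g p) (hh : ContDiffAt ℝ 2 h (F p)) (hg' : fderiv ℝ g p = 0)
    (hh' : fderiv ℝ h (F p) = 0) (hsymm : ∀ a b, h (F p) a b = h (F p) b a)
    (hnondeg : ∀ a, (∀ b, h (F p) a b = 0) → a = 0) (hsurj : Function.Surjective (fderiv ℝ F p))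
    (x a : V) :
    sectionalForm h (F p) (fderiv ℝ F p x) (fderiv ℝ F p a) = sectionalForm g p x a := by
  have hF' := hiso.fderiv_fderiv_map_eq_zero (hF.of_le (by norm_num)) (hg.of_le (by norm_num))
    (hh.of_le (by norm_num)) hg' hh' hsymm hnondeg hsurj
  have hdiff := hiso.fderiv_fderiv_metric_eq hF hg hh hh' hF'
  have hleft : IsSymmSndFDerivAt ℝ (fderiv ℝ F) p :=
    (hF.fderiv_right (m := 2) (by norm_num)).isSymmSndFDerivAt (by simp)
  have hxax : fderiv ℝ (fderiv ℝ (fderiv ℝ F)) p x a x =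
      fderiv ℝ (fderiv ℝ (fderiv ℝ F)) p x x a := fderiv_fderiv_fderiv_swap_right hF x a x
  have hxaa : fderiv ℝ (fderiv ℝ (fderiv ℝ F)) p x a a =
      fderiv ℝ (fderiv ℝ (fderiv ℝ F)) p a a x := by
    rw [hleft.eq x a, fderiv_fderiv_fderiv_swap_right hF a x a]
  rw [sectionalForm, sectionalForm, ← hdiff, ← hdiff, ← hdiff, hxax, hxaa,
    hsymm _ (fderiv ℝ (fderiv ℝ (fderiv ℝ F)) p x x a),
    hsymm _ (fderiv ℝ (fderiv ℝ (fderiv ℝ F)) p a a x)]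
  ring

end Isometric

/-! ### Isometries in a chart -/

section ChartExpression

variable {E : Type*} [NormedAddCommGroup E] [NormedSpace ℝ E]
  {M : Type*} [TopologicalSpace M] [ChartedSpace E M]

theorem mfderiv_eq_fderiv_chartAt {E' : Type*} [NormedAddCommGroup E'] [NormedSpace ℝ E']
    {M' : Type*} [TopologicalSpace M'] [ChartedSpace E' M'] {f : M → M'} {q : M}
    (hf : MDifferentiableAt 𝓘(ℝ, E) 𝓘(ℝ, E') f q) (a : E) :
    (mfderiv 𝓘(ℝ, E) 𝓘(ℝ, E') f q a : E') =
      fderiv ℝ (chartAt E' (f q) ∘ f ∘ (chartAt E q).symm) (chartAt E q q) a := by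
  rw [hf.mfderiv]
  simp only [writtenInExtChartAt, extChartAt, mfld_simps, fderivWithin_univ]
  rfl

variable {e : OpenPartialHomeomorph M E} {G : E → E →L[ℝ] E →L[ℝ] ℝ}
  {g : ∀ q : M, LinearMap.BilinForm ℝ (TangentSpace 𝓘(ℝ, E) q)}

theorem IsLocalIsometry.isIsometricNear {f : PartialDiffeomorph 𝓘(ℝ, E) 𝓘(ℝ, E) M M ∞}
    (hf : IsLocalIsometry 𝓘(ℝ, E) g f) (he : ∀ q ∈ e.source, chartAt E q = e)
    (hG : ∀ q ∈ e.source, ∀ a b : E, g q a b = G (e q) a b) {p : M} (hp : p ∈ f.source)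
    (hpe : p ∈ e.source) (hfp : f p ∈ e.source) :
    IsIsometricNear G G (e ∘ f ∘ e.symm) (e p) := by
  have hsource : ∀ᶠ q in 𝓝 p, q ∈ e.source ∧ q ∈ f.source ∧ f q ∈ e.source :=
    (e.open_source.eventually_mem hpe).and <| (f.open_source.eventually_mem hp).and <|
      (f.mdifferentiableAt (by simp) hp).continuousAt.eventually (e.open_source.eventually_mem hfp)
  have htendsto : Filter.Tendsto e.symm (𝓝 (e p)) (𝓝 p) := e.tendsto_symm hpe
  filter_upwards [htendsto.eventually hsource, e.open_target.mem_nhds (e.map_source hpe)]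
    with x ⟨hxe, hxf, hfx⟩ hx a b
  have hd (c : E) := mfderiv_eq_fderiv_chartAt (f.mdifferentiableAt (by simp) hxf) c
  simp only [he _ hxe, he _ hfx, e.right_inv hx] at hd
  calc G (e (f (e.symm x))) (fderiv ℝ (e ∘ f ∘ e.symm) x a) (fderiv ℝ (e ∘ f ∘ e.symm) x b)
      = g (f (e.symm x)) (mfderiv 𝓘(ℝ, E) 𝓘(ℝ, E) f (e.symm x) a)
          (mfderiv 𝓘(ℝ, E) 𝓘(ℝ, E) f (e.symm x) b) := by
        rw [← hd, ← hd]; exact (hG _ hfx _ _).symm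
    _ = g (e.symm x) a b := hf _ hxf a b
    _ = G x a b := by
        rw [hG _ hxe, e.right_inv hx]

theorem ExistsLocalIsometryMapping.exists_isIsometricNear {p : M} {v w : E}
    (h : ExistsLocalIsometryMapping 𝓘(ℝ, E) g p v w) (he : ∀ q ∈ e.source, chartAt E q = e)
    (hG : ∀ q ∈ e.source, ∀ a b : E, g q a b = G (e q) a b) (hp : p ∈ e.source) :
    ∃ F : E → E, ContDiffAt ℝ ∞ F (e p) ∧ F (e p) = e p ∧ IsIsometricNear G G F (e p) ∧
      fderiv ℝ F (e p) v = w := by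
  obtain ⟨f, hpf, hf, hvw⟩ := h
  have hfp : f p = p := congrArg Bundle.TotalSpace.proj hvw
  have hfpe : f p ∈ e.source := hfp.symm ▸ hp
  refine ⟨e ∘ f ∘ e.symm, ?_, ?_, hf.isIsometricNear he hG hpf hp hfpe, ?_⟩
  · have hcont := (contMDiffAt_iff.1 (f.contMDiffOn.contMDiffAt (f.open_source.mem_nhds hpf))).2
    simpa only [extChartAt, he _ hp, he _ hfpe, mfld_simps, contDiffWithinAt_univ] using hcont
  · simp only [Function.comp_apply, e.left_inv hp, hfp]
  · have hd := mfderiv_eq_fderiv_chartAt (f.mdifferentiableAt (by simp) hpf) v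
    simp only [he _ hp, he _ hfpe] at hd
    exact hd.symm.trans (congrArg (fun z : TangentBundle 𝓘(ℝ, E) M => (z.2 : E)) hvw)

end ChartExpression

/-! ### The curvature of the para-octonionic plane at the base point -/

namespace ParaOct

open scoped Quaternion

instance : FiniteDimensional ℝ ParaOct :=
  inferInstanceAs (FiniteDimensional ℝ (Quaternion ℝ × Quaternion ℝ))

protected theorem zero_mul (a : ParaOct) : 0 * a = 0 := by ext1 <;> simp

protected theorem mul_zero (a : ParaOct) : a * 0 = 0 := by ext1 <;> simp

theorem conj_zero : conj 0 = 0 := by ext1 <;> simp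

theorem re_zero : re 0 = 0 := rfl

theorem ip_eq (a b : ParaOct) :
    ip a b = (a.1.re * b.1.re + a.1.imI * b.1.imI + a.1.imJ * b.1.imJ + a.1.imK * b.1.imK)
      - (a.2.re * b.2.re + a.2.imI * b.2.imI + a.2.imJ * b.2.imJ + a.2.imK * b.2.imK) := by
  simp [ip, re]; ring

theorem ip_comm (a b : ParaOct) : ip a b = ip b a := by simp only [ip_eq]; ring

theorem ip_self (a : ParaOct) : ip a a = nsq a := rfl

theorem ip_zero (a : ParaOct) : ip a 0 = 0 := by
  rw [ip, conj_zero, ParaOct.mul_zero, re_zero]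

theorem ip_add_right (a b c : ParaOct) : ip a (b + c) = ip a b + ip a c := by
  rw [ip, conj_add, ParaOct.mul_add, re_add, ip, ip]

theorem nsq_zero : nsq 0 = 0 := ip_zero 0

theorem nsq_add (a b : ParaOct) : nsq (a + b) = nsq a + 2 * ip a b + nsq b := by
  simp only [nsq, ip_add_right, ip_comm (a + b)]
  rw [ip_comm b a]
  ring

theorem fst_i : i.1 = ⟨0, 1, 0, 0⟩ := rfl

theorem snd_i : i.2 = 0 := rfl

theorem nsq_i : nsq i = 1 := by simp [nsq_eq, fst_i, snd_i]

theorem nsq_l : nsq l = -1 := by simp [nsq_eq, l]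

theorem ip_i_l : ip i l = 0 := by simp [ip_eq, fst_i, snd_i, l]

theorem ip_i_one : ip i 1 = 0 := by simp [ip_eq, fst_i]

theorem nsq_i_add_l : nsq (i + l) = 0 := by
  rw [nsq_add, nsq_i, nsq_l, ip_i_l]; norm_num

protected theorem one_ne_zero : (1 : ParaOct) ≠ 0 := fun h => by
  simpa only [h, nsq_zero, zero_ne_one] using nsq_one

theorem i_add_l_ne_zero : i + l ≠ 0 := fun h => by
  have hip := ip_add_right i i l
  rw [h, ip_zero, ip_i_l, add_zero] at hip
  exact zero_ne_one (hip.trans nsq_i)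

theorem re_mul_conj_mul_mul_conj (a b : ParaOct) :
    re ((a * conj b) * (b * conj a)) = nsq a * nsq b := by
  rw [core_identity _ _ _ (Or.inr (Or.inr (Or.inl rfl))), re_smul, mul_comm]; rfl

theorem contDiff_fun_mul {E : Type*} [NormedAddCommGroup E] [NormedSpace ℝ E] {f g : E → ParaOct}
    (hf : ContDiff ℝ ∞ f) (hg : ContDiff ℝ ∞ g) : ContDiff ℝ ∞ fun x => f x * g x :=
  contDiff_mul.comp (hf.prodMk hg)

theorem contDiff_re : ContDiff ℝ ∞ re :=
  (LinearMap.toContinuousLinearMap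
    { toFun := re, map_add' := re_add, map_smul' := re_smul }).contDiff

theorem eq_zero_of_forall_ip {a : ParaOct} (h : ∀ b, ip a b = 0) : a = 0 := by
  have hsum : Quaternion.normSq a.1 + Quaternion.normSq a.2 = 0 := by
    rw [← h (mk a.1 (-a.2)), ip_eq, Quaternion.normSq_def', Quaternion.normSq_def']
    simp
    ring
  have h₁ := Quaternion.normSq_nonneg (a := a.1)
  have h₂ := Quaternion.normSq_nonneg (a := a.2)
  exact ParaOct.ext (Quaternion.normSq_eq_zero.1 (by linarith))
    (Quaternion.normSq_eq_zero.1 (by linarith))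

end ParaOct

namespace ParaOctPlane

open ParaOct

/-- The part of the numerator of `metricForm x` that is quadratic in the base point `x`. -/
noncomputable def metricQuad (x a b : ParaOctPair) : ℝ :=
  ip a.1 b.1 * nsq x.2 + ip a.2 b.2 * nsq x.1
    - re ((x.1 * conj x.2) * (a.2 * conj b.1)) - re ((x.1 * conj x.2) * (b.2 * conj a.1))

theorem metricForm_zero_apply (a b : ParaOctPair) :
    metricForm 0 a b = ip a.1 b.1 + ip a.2 b.2 := by
  simp [metricForm, ParaOct.zero_mul, re_zero, nsq_zero]

theorem metricForm_smul_apply (t : ℝ) (x a b : ParaOctPair) :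
    metricForm (t • x) a b = (metricForm 0 a b + t ^ 2 * metricQuad x a b)
      / (1 + t ^ 2 * (nsq x.1 + nsq x.2)) ^ 2 := by
  rw [metricForm_zero_apply]
  simp only [metricForm, LinearMap.mk₂_apply, metricQuad, Prod.smul_fst, Prod.smul_snd, nsq_smul,
    conj_smul, smul_mul, ParaOct.mul_smul, re_smul]
  ring

theorem metricForm_neg (x : ParaOctPair) : metricForm (-x) = metricForm x := by
  refine LinearMap.ext₂ fun a b => ?_
  have hpos := metricForm_smul_apply 1 x a b
  have hneg := metricForm_smul_apply (-1) x a b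
  rw [neg_one_smul] at hneg
  rw [one_smul] at hpos
  rw [hneg, hpos, neg_one_sq, one_pow]

theorem metricForm_comm (x a b : ParaOctPair) : metricForm x a b = metricForm x b a := by
  simp only [metricForm, LinearMap.mk₂_apply, ip_comm a.1, ip_comm a.2]
  ring

theorem eq_zero_of_metricForm_zero {a : ParaOctPair} (h : ∀ b, metricForm 0 a b = 0) : a = 0 := by
  simp only [metricForm_zero_apply] at h
  exact Prod.ext
    (eq_zero_of_forall_ip fun b => by simpa only [ip_zero, add_zero] using h (b, 0))
    (eq_zero_of_forall_ip fun b => by simpa only [ip_zero, zero_add] using h (0, b))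

/-- `metricForm` as a map into continuous bilinear forms, which can be differentiated. -/
noncomputable def metricCLM (x : ParaOctPair) : ParaOctPair →L[ℝ] ParaOctPair →L[ℝ] ℝ :=
  (metricForm x).toContinuousBilinearMap

theorem metricCLM_apply (x a b : ParaOctPair) : metricCLM x a b = metricForm x a b := rfl

theorem contDiffOn_metricForm_apply (a b : ParaOctPair) :
    ContDiffOn ℝ ∞ (fun x => metricForm x a b) chartTarget := by
  have hfst : ContDiff ℝ ∞ fun x : ParaOctPair => nsq x.1 := contDiff_nsq.comp contDiff_fst
  have hsnd : ContDiff ℝ ∞ fun x : ParaOctPair => nsq x.2 := contDiff_nsq.comp contDiff_snd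
  have hcross (c : ParaOct) : ContDiff ℝ ∞ fun x : ParaOctPair => re ((x.1 * conj x.2) * c) :=
    contDiff_re.comp (contDiff_fun_mul
      (contDiff_fun_mul contDiff_fst (contDiff_conj.comp contDiff_snd)) contDiff_const)
  have hmain : ContDiff ℝ ∞ fun x : ParaOctPair =>
      ip a.1 b.1 * (1 + nsq x.2) + ip a.2 b.2 * (1 + nsq x.1) :=
    (contDiff_const.mul (contDiff_const.add hsnd)).add
      (contDiff_const.mul (contDiff_const.add hfst))
  have hden : ContDiff ℝ ∞ fun x : ParaOctPair => (1 + nsq x.1 + nsq x.2) ^ 2 :=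
    ((contDiff_const.add hfst).add hsnd).pow 2
  simp only [metricForm, LinearMap.mk₂_apply]
  exact ((hmain.sub (hcross _)).sub (hcross _)).contDiffOn.div hden.contDiffOn
    fun x hx => pow_ne_zero 2 (ne_of_gt hx)

theorem contDiffAt_metricCLM : ContDiffAt ℝ ∞ metricCLM 0 :=
  (contDiffOn_clm_apply.2 fun a => contDiffOn_clm_apply.2 fun b =>
    contDiffOn_metricForm_apply a b).contDiffAt
      (isOpen_chartTarget.mem_nhds (by simp [chartTarget, nsq_zero]))

theorem fderiv_metricCLM : fderiv ℝ metricCLM 0 = 0 :=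
  fderiv_zero_of_even fun x => by rw [metricCLM, metricForm_neg, ← metricCLM]

theorem fderiv_fderiv_metricCLM (x a b : ParaOctPair) :
    fderiv ℝ (fderiv ℝ metricCLM) 0 x x a b =
      2 * (metricQuad x a b - 2 * metricForm 0 a b * (nsq x.1 + nsq x.2)) := by
  rw [← deriv_deriv_apply_apply (contDiffAt_metricCLM.of_le (by norm_cast))]
  simp only [zero_add, metricCLM_apply, metricForm_smul_apply, deriv_deriv_div_sq]

theorem sectionalForm_metricCLM (u a₁ a₂ : ParaOct) :
    sectionalForm metricCLM 0 (u, 0) (a₁, a₂) =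
      4 * (nsq u * nsq a₁ - ip u a₁ ^ 2) + nsq u * nsq a₂ := by
  rw [sectionalForm_eq_diag (contDiffAt_metricCLM.of_le (by norm_cast))]
  simp only [fderiv_fderiv_metricCLM, metricQuad, metricForm_zero_apply, Prod.mk_add_mk, zero_add,
    ParaOct.zero_mul, ParaOct.mul_zero, conj_zero, re_zero, nsq_add, ip_zero, nsq_zero,
    ip_comm 0, ip_self, ParaOct.add_mul, re_add, re_mul_conj_mul_mul_conj]
  ring

theorem chartAt_of_mem {P : ParaOctPlane} (hP : P ∈ chartSource 0) :
    chartAt ParaOctPair P = chart 0 := by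
  classical
  rw [chartAt_eq]
  congr 1
  exact (Fin.find_eq_iff _).2 ⟨hP, fun j hj => absurd hj (Fin.not_lt_zero j)⟩

theorem basePoint_mem_chartSource : basePoint ∈ chartSource 0 := by
  rw [basePoint, mk_mem_chartSource]
  simp [nsq_one]

theorem chart_basePoint : chart 0 basePoint = 0 :=
  Prod.ext (coord_mk_of_eq_one (j := 1) rfl) (coord_mk_of_eq_one (j := 2) rfl)

theorem metric_baseVec_self (a b : ParaOct) :
    metric basePoint (baseVec a b) (baseVec a b) = nsq a + nsq b := by
  rw [metric, chartAt_basePoint, chart_basePoint]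
  exact metricForm_zero_apply _ _

theorem baseVec_ne_zero {a b : ParaOct} (ha : a ≠ 0) : baseVec a b ≠ 0 :=
  fun h => ha (congrArg Prod.fst (h : ((a, b) : ParaOctPair) = 0))

theorem metric_eq_metricCLM (P : ParaOctPlane) (hP : P ∈ chartSource 0) (a b : ParaOctPair) :
    metric P a b = metricCLM (chart 0 P) a b := by
  rw [metric, chartAt_of_mem hP]
  rfl

theorem sectionalForm_metricCLM_one_l_i_zero :
    sectionalForm metricCLM 0 (1, l) (i, 0) = 3 := by
  rw [sectionalForm_comm (contDiffAt_metricCLM.of_le (by norm_cast)) metricForm_comm,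
    sectionalForm_metricCLM, nsq_i, nsq_one, nsq_l, ip_i_one]
  norm_num

theorem fderiv_apply_ne_of_nsq_eq_zero {F : ParaOctPair → ParaOctPair} {e : ParaOct}
    (hF : ContDiffAt ℝ 3 F 0) (hF0 : F 0 = 0) (hiso : IsIsometricNear metricCLM metricCLM F 0)
    (he : nsq e = 0) : fderiv ℝ F 0 (e, 0) ≠ (1, l) := by
  intro hd
  have hnondeg (a : ParaOctPair) (ha : ∀ b, metricCLM 0 a b = 0) : a = 0 :=
    eq_zero_of_metricForm_zero ha
  have hsurj : Function.Surjective (fderiv ℝ F 0) :=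
    LinearMap.injective_iff_surjective.1 (hiso.injective_fderiv hnondeg)
  obtain ⟨a, ha⟩ := hsurj (i, 0)
  have hg : ContDiffAt ℝ 2 metricCLM 0 := contDiffAt_metricCLM.of_le (by norm_cast)
  have hcurv : sectionalForm metricCLM 0 (1, l) (i, 0) = sectionalForm metricCLM 0 (e, 0) a := by
    have h := hiso.sectionalForm_eq hF hg (by rwa [hF0]) fderiv_metricCLM
      (by rw [hF0, fderiv_metricCLM]) (metricForm_comm _) (by rwa [hF0]) hsurj (e, 0) a
    rwa [hF0, hd, ha] at h
  rw [sectionalForm_metricCLM_one_l_i_zero, ← a.eta, sectionalForm_metricCLM, he] at hcurv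
  nlinarith [sq_nonneg (ip e a.1)]

theorem not_existsLocalIsometryMapping {e : ParaOct} (he : nsq e = 0) :
    ¬ ExistsLocalIsometryMapping 𝓘(ℝ, ParaOctPair) metric basePoint
      (baseVec e 0) (baseVec 1 l) := by
  intro h
  obtain ⟨F, hF, hF0, hiso, hd⟩ := h.exists_isIsometricNear (e := chart 0)
    (fun _ => chartAt_of_mem) metric_eq_metricCLM basePoint_mem_chartSource
  rw [chart_basePoint] at hF hF0 hiso hd
  exact fderiv_apply_ne_of_nsq_eq_zero (hF.of_le (by norm_cast)) hF0 hiso he hd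

end ParaOctPlane

/-- The vectors `v = (i+l, 0)` and `w = (1, l)` at `[1,0,0] ∈ 𝕆'P²` are non-zero and null, no local
isometry of `𝕆'P²` fixing `[1,0,0]` maps `v` to `w`, and so `𝕆'P²` is not locally isotropic. -/
theorem mainTheorem5 :
    (ParaOctPlane.baseVec (ParaOct.i + ParaOct.l) 0 ≠ 0 ∧
      ParaOctPlane.baseVec 1 ParaOct.l ≠ 0 ∧
      ParaOctPlane.metric ParaOctPlane.basePoint
        (ParaOctPlane.baseVec (ParaOct.i + ParaOct.l) 0)
        (ParaOctPlane.baseVec (ParaOct.i + ParaOct.l) 0) = 0 ∧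
      ParaOctPlane.metric ParaOctPlane.basePoint
        (ParaOctPlane.baseVec 1 ParaOct.l) (ParaOctPlane.baseVec 1 ParaOct.l) = 0 ∧
      ¬ ExistsLocalIsometryMapping 𝓘(ℝ, ParaOctPair) ParaOctPlane.metric ParaOctPlane.basePoint
        (ParaOctPlane.baseVec (ParaOct.i + ParaOct.l) 0) (ParaOctPlane.baseVec 1 ParaOct.l)) ∧
    ¬ IsLocallyIsotropic 𝓘(ℝ, ParaOctPair) ParaOctPlane.metric := by
  have hv : ParaOctPlane.baseVec (ParaOct.i + ParaOct.l) 0 ≠ 0 :=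
    ParaOctPlane.baseVec_ne_zero ParaOct.i_add_l_ne_zero
  have hw : ParaOctPlane.baseVec 1 ParaOct.l ≠ 0 :=
    ParaOctPlane.baseVec_ne_zero ParaOct.one_ne_zero
  have hvv : ParaOctPlane.metric ParaOctPlane.basePoint
      (ParaOctPlane.baseVec (ParaOct.i + ParaOct.l) 0)
      (ParaOctPlane.baseVec (ParaOct.i + ParaOct.l) 0) = 0 := by
    rw [ParaOctPlane.metric_baseVec_self, ParaOct.nsq_i_add_l, ParaOct.nsq_zero, add_zero]
  have hww : ParaOctPlane.metric ParaOctPlane.basePoint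
      (ParaOctPlane.baseVec 1 ParaOct.l) (ParaOctPlane.baseVec 1 ParaOct.l) = 0 := by
    rw [ParaOctPlane.metric_baseVec_self, ParaOct.nsq_one, ParaOct.nsq_l, add_neg_cancel]
  have hnot := ParaOctPlane.not_existsLocalIsometryMapping ParaOct.nsq_i_add_l
  exact ⟨⟨hv, hw, hvv, hww, hnot⟩, fun hiso => hnot (hiso _ _ _ hv hw (hvv.trans hww.symm))⟩
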